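/- For positive integers $m$ and $\delta$, a chain of length $\delta$ over $[m]=\{1,\dots,m\}$ is a nested sequence $\langle A_0,A_1,\dots,A_\delta\rangle$ of sets $A_0\subseteq A_1\subseteq\cdots\subseteq A_\delta\subseteq[m]$ with $|A_0|=1$; its size is $|A_\delta|$, and if $A_0=\{\alpha\}$ it is also written $\langle\alpha,A_1,\dots,A_\delta\rangle$. Let $U(m,R,\delta)$ be the graph whose vertices are all chains over $[m]$ of length $\delta$ and size at most $R$, in which $\langle\alpha,A_1,\dots,A_\delta\rangle$ and $\langle\beta,B_1,\dots,B_\delta\rangle$ are adjacent if and only if $\alpha\neq\beta$, $\alpha\in B_1$, $\beta\in A_1$, and $A_i\subseteq B_{i+1}$ and $B_i\subseteq A_{i+1}$ for all $1\le i\le\delta-1$. Let $\chi$ denote the chromatic number and $\log^{(j)}$ the base-2 logarithm iterated $j$ times. Let $\delta\ge 1$ and $R\ge 2\delta+1$ be fixed integers. Then, as $m\to\infty$, $$\chi(U(m,R,\delta)) > 2^{\frac{R-2\delta-4}{2}}\cdot\log^{(2\delta)}m+o(1),$$ that is, there is a function $\varepsilon:\mathbb N\to\mathbb R$ (which may depend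 on $R$ and $\delta$) with $\varepsilon(m)\to 0$ as $m\to\infty$ such that $\chi(U(m,R,\delta)) > 2^{(R-2\delta-4)/2}\log^{(2\delta)}m+\varepsilon(m)$ for all sufficiently large $m$. -/

import Mathlib

open Filter Topology

namespace ChainGraph

/-- A chain of length `f` over the universe `[m]` (modelled by `Fin m`): a nested sequence
`A 0 ⊆ A 1 ⊆ ⋯ ⊆ A f ⊆ [m]` with `|A 0| = 1`. -/
structure Chain (m f : ℕ) where
  /-- the sets of the chain -/
  set : Fin (f + 1) → Finset (Fin m)
  nested : ∀ i : Fin f, set i.castSucc ⊆ set i.succ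
  card_zero : (set 0).card = 1

/-- The size of a chain is the cardinality of its last set. -/
def Chain.size {m f : ℕ} (A : Chain m f) : ℕ := (A.set (Fin.last f)).card

/-- The vertices of `U(m, R, δ)`: the chains over `[m]` of length `δ` and size at most `R`. -/
def Vertex (m R δ : ℕ) : Type := {A : Chain m δ // A.size ≤ R}

/-- The graph `U(m, R, δ)`. Chains `⟨α, A 1, …, A δ⟩` and `⟨β, B 1, …, B δ⟩` are adjacent iff
`α ≠ β`, `α ∈ B 1`, `β ∈ A 1`, and `A i ⊆ B (i+1)`, `B i ⊆ A (i+1)` for `1 ≤ i ≤ δ - 1`.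
As `A 0 = {α}` and `B 0 = {β}`, the memberships `α ∈ B 1` and `β ∈ A 1` are the inclusions
at the index `i = 0`. -/
def U (m R δ : ℕ) : SimpleGraph (Vertex m R δ) where
  Adj A B := A.1.set 0 ≠ B.1.set 0 ∧
    ∀ i : Fin δ, A.1.set i.castSucc ⊆ B.1.set i.succ ∧ B.1.set i.castSucc ⊆ A.1.set i.succ
  symm := ⟨fun _ _ h => ⟨h.1.symm, fun i => (h.2 i).symm⟩⟩
  loopless := ⟨fun _ h => h.1 rfl⟩

instance (m R δ : ℕ) : Finite (Vertex m R δ) :=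
  Finite.of_injective (fun A : Vertex m R δ => A.1.set) (by
    rintro ⟨⟨a, _, _⟩, _⟩ ⟨⟨b, _, _⟩, _⟩ h
    have h' : a = b := h
    subst h'
    rfl)

/-- The chromatic number of `U(m, R, δ)`, as a natural number. -/
noncomputable def chiU (m R δ : ℕ) : ℕ := (U m R δ).chromaticNumber.toNat

/-- `U(m, R, δ)` is finite, so that no information is lost in `chiU`. -/
theorem coe_chiU (m R δ : ℕ) : (chiU m R δ : ℕ∞) = (U m R δ).chromaticNumber := by
  have := Fintype.ofFinite (Vertex m R δ)
  exact ENat.natCast_toNat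
    (SimpleGraph.chromaticNumber_ne_top_iff_exists.2 ⟨_, (U m R δ).colorable_of_fintype⟩)

/-- The base-2 logarithm iterated `j` times. -/
noncomputable def iterLog (j : ℕ) (x : ℝ) : ℝ := (Real.logb 2)^[j] x

end ChainGraph

/-!
Write `δ = d + 1` and `R = 2δ + 1 + t`. An increasing `(2d + 1)`-tuple `q` of elements of `[m]`
gives a chain of length `d` around its middle entry, and every set `S` of size at most `R`
containing the entries of `q` extends it to a vertex of `U(m, R, δ)`. If `q` follows `p` in the
shift graph, the vertices `(p, S)` and `(q, T)` are adjacent as soon as `S` and `T` contain all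
entries of both tuples (`adj_centredChain`). A colouring of `U(m, R, δ)` by `k` colours is used
only through this property (`IsTopColoring`).

For `t = 0` two power set steps turn such a colouring into a colouring of the shift graph on
`(2d + 1)`-tuples by `2 ^ 2 ^ k` colours. Each spare element in `S` halves the exponent `k`: if
`q` follows `p`, then the colours of the sets `S` at `p` containing `q` and those of the sets `T`
at `q` containing `p` are disjoint, so for one of the two tuples a single additional element
confines the colours to half of the palette. Hence the tuples for which no element does so are
independent in the shift graph, and the others are split according to their remaining palette, at
the cost of a factor `2 ^ k` in the number of colours. After `t` rounds the shift graph has a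
colouring by about `2 ^ (t k) * 2 ^ 2 ^ (k / 2 ^ t)` colours (`IsTopColoring.diColorable`).

Since a colouring of the shift graph on `(n + 1)`-tuples by `M` colours forces `m` to be at most
the `n`-fold iterated exponential of `M` (`le_iterate_of_diColorable_shift`), it follows that `k` is
at least `2 ^ t * log^(2δ) m` up to lower order terms. This exceeds the claimed coefficient
`2 ^ ((t - 3) / 2)` by a factor of more than `2`, which absorbs the lower order terms, so that the
error function can be taken to be `0`.
-/

namespace ChainGraph

/-! ### Colourings of digraphs -/

section Digraph

variable {V : Type*} {X : Type*}

/-- The digraph that `r` induces on `W` has a proper colouring with at most `M` colours. -/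
def DiColorable (r : V → V → Prop) (W : Set V) (M : ℕ) : Prop :=
  ∃ c : V → ℕ, (∀ q ∈ W, c q < M) ∧ ∀ p ∈ W, ∀ q ∈ W, r p q → c p ≠ c q

theorem DiColorable.of_finset {r : V → V → Prop} {W : Set V} {M : ℕ} {β : Type*}
    (c : V → β) (P : Finset β) (hP : P.card ≤ M) (hc : ∀ q ∈ W, c q ∈ P)
    (h : ∀ p ∈ W, ∀ q ∈ W, r p q → c p ≠ c q) : DiColorable r W M := by
  classical
  refine ⟨fun q => if hq : c q ∈ P then P.equivFin ⟨c q, hq⟩ else 0, fun q hq => ?_,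
    fun p hp q hq hr heq => h p hp q hq hr ?_⟩
  · simp only [hc q hq, dif_pos]
    exact (Fin.is_lt _).trans_le hP
  · simp only [hc q hq, hc p hp, dif_pos] at heq
    simpa using P.equivFin.injective (Fin.ext heq)

variable [Fintype X] [DecidableEq X]

/-- The palette of `q` over `s`: the colours `f q S` over all sets `S` of size at most `R` that
contain `N q` and `s`. -/
def palette (N : V → Finset X) (R : ℕ) (f : V → Finset X → ℕ) (q : V) (s : Finset X) :
    Finset ℕ :=
  (Finset.univ.filter fun S : Finset X => N q ⊆ S ∧ s ⊆ S ∧ S.card ≤ R).image (f q)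

variable {N : V → Finset X} {R : ℕ} {f : V → Finset X → ℕ}

theorem mem_palette {q : V} {s S : Finset X} (h₁ : N q ⊆ S) (h₂ : s ⊆ S) (h₃ : S.card ≤ R) :
    f q S ∈ palette N R f q s :=
  Finset.mem_image_of_mem _ (by simp [h₁, h₂, h₃])

theorem palette_anti {q : V} {s s' : Finset X} (h : s ⊆ s') :
    palette N R f q s' ⊆ palette N R f q s := by
  apply Finset.image_subset_image
  intro S
  simp only [Finset.mem_filter, Finset.mem_univ, true_and]
  exact fun hS => ⟨hS.1, h.trans hS.2.1, hS.2.2⟩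

/-- `f q S` behaves like the colour of an object formed from `q` and a set `S ⊇ N q` of size at
most `R`: along an arc `p → q` the objects of `p` and `q` are adjacent as soon as both sets
contain `N p ∪ N q`. -/
def IsTopColoring (r : V → V → Prop) (N : V → Finset X) (R : ℕ) (f : V → Finset X → ℕ) : Prop :=
  ∀ p q, r p q → ∀ S T : Finset X, S.card ≤ R → T.card ≤ R → N p ⊆ S → N q ⊆ S → N p ⊆ T →
    N q ⊆ T → f p S ≠ f q T

theorem IsTopColoring.disjoint_palette {r : V → V → Prop} (hf : IsTopColoring r N R f) {p q : V}
    (hr : r p q) {s s' : Finset X} (hs : N q ⊆ N p ∪ s) (hs' : N p ⊆ N q ∪ s') :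
    Disjoint (palette N R f p s) (palette N R f q s') := by
  rw [Finset.disjoint_left]
  simp only [palette, Finset.mem_image, Finset.mem_filter, Finset.mem_univ, true_and]
  rintro _ ⟨S, ⟨h1, h2, h3⟩, rfl⟩ ⟨T, ⟨h4, h5, h6⟩, h⟩
  exact hf p q hr S T h3 h6 h1 (hs.trans (Finset.union_subset h1 h2))
    (hs'.trans (Finset.union_subset h4 h5)) h4 h.symm

/-- The double power set step: `q` is coloured by the family, over the arcs `q → u`, of the sets
of colours seen on the walks `p → q → u`. -/
theorem IsTopColoring.diColorable_of_palette_subset [Finite V] {r : V → V → Prop}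
    (hf : IsTopColoring r N R f) (hN : ∀ p q, r p q → ∃ z, N q ⊆ insert z (N p))
    (hN' : ∀ p q, r p q → ∃ z, N p ⊆ insert z (N q)) {n e : ℕ} (hn : ∀ q, (N q).card ≤ n)
    (W : Set V) (s : V → Finset X) (K : Finset ℕ)
    (hs : ∀ q ∈ W, (s q).card + n + 2 ≤ R) (hK : ∀ q ∈ W, palette N R f q (s q) ⊆ K)
    (he : K.card ≤ e) : DiColorable r W (2 ^ 2 ^ e) := by
  classical
  have := Fintype.ofFinite V
  let g : V → V → V → ℕ := fun p q u => f q (N p ∪ N q ∪ N u ∪ s q)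
  have hcard : ∀ p q u, q ∈ W → r p q → r q u → (N p ∪ N q ∪ N u ∪ s q).card ≤ R := by
    intro p q u hq hpq hqu
    obtain ⟨y, hy⟩ := hN' p q hpq
    obtain ⟨z, hz⟩ := hN q u hqu
    have hsub : N p ∪ N q ∪ N u ∪ s q ⊆ insert y (insert z (N q)) ∪ s q := by
      intro a ha
      have h1 := @hy a
      have h2 := @hz a
      simp only [Finset.mem_union, Finset.mem_insert] at *
      tauto
    have h1 := Finset.card_le_card hsub
    have h2 := Finset.card_union_le (insert y (insert z (N q))) (s q)
    have h3 := Finset.card_insert_le y (insert z (N q))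
    have h4 := Finset.card_insert_le z (N q)
    have h5 := hn q
    have h6 := hs q hq
    omega
  let A : V → V → Finset ℕ := fun q u =>
    (Finset.univ.filter fun p => p ∈ W ∧ r p q).image fun p => g p q u
  let B : V → Finset (Finset ℕ) := fun q =>
    (Finset.univ.filter fun u => u ∈ W ∧ r q u).image fun u => A q u
  refine DiColorable.of_finset B K.powerset.powerset ?_ ?_ ?_
  · rw [Finset.card_powerset, Finset.card_powerset]
    exact Nat.pow_le_pow_right two_pos (Nat.pow_le_pow_right two_pos he)
  · intro q hq
    simp only [Finset.mem_powerset]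
    intro a ha
    simp only [B, Finset.mem_image, Finset.mem_filter, Finset.mem_univ, true_and] at ha
    obtain ⟨u, ⟨-, hqu⟩, rfl⟩ := ha
    rw [Finset.mem_powerset]
    intro c hc
    simp only [A, Finset.mem_image, Finset.mem_filter, Finset.mem_univ, true_and] at hc
    obtain ⟨p, ⟨-, hpq⟩, rfl⟩ := hc
    refine hK q hq (mem_palette ?_ Finset.subset_union_right (hcard p q u hq hpq hqu))
    intro a; simp only [Finset.mem_union]; tauto
  · -- If `B q = B u`, then `A q u = A u v` for some `v`, and the colour of `q → u → v`, which
    -- lies in `A u v`, is also the colour of a walk `p → q → u`.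
    intro q hq u hu hqu heq
    have hmem : A q u ∈ B u := by
      rw [← heq]
      exact Finset.mem_image_of_mem _ (by simp [hu, hqu])
    simp only [B, Finset.mem_image, Finset.mem_filter, Finset.mem_univ, true_and] at hmem
    obtain ⟨v, ⟨-, huv⟩, hA⟩ := hmem
    have hmem : g q u v ∈ A q u := by
      rw [← hA]
      exact Finset.mem_image_of_mem _ (by simp [hq, hqu])
    simp only [A, Finset.mem_image, Finset.mem_filter, Finset.mem_univ, true_and] at hmem
    obtain ⟨p, ⟨-, hpq⟩, hg⟩ := hmem
    refine hf q u hqu _ _ (hcard p q u hq hpq hqu) (hcard q u v hu hqu huv) ?_ ?_ ?_ ?_ hg <;>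
      (intro a; simp only [Finset.mem_union]; tauto)

/-- Each of the `t` spare elements halves the palette. Call `q` good if the palette over
`s q` can be halved by one more element. Along an arc `p → q` the palettes of `p` and `q`, with
the missing element of `N q` and of `N p` adjoined, are disjoint subsets of `K`, so one of them
has at most half the size of `K`: the vertices that are not good take a single colour. The good
ones are first coloured by their halved palette, and then treated inductively. -/
theorem IsTopColoring.diColorable [Finite V] {r : V → V → Prop}
    (hf : IsTopColoring r N R f) (hN : ∀ p q, r p q → ∃ z, N q ⊆ insert z (N p))
    (hN' : ∀ p q, r p q → ∃ z, N p ⊆ insert z (N q)) {n e k : ℕ} (hn : ∀ q, (N q).card ≤ n)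
    (t : ℕ) (W : Set V) (s : V → Finset X) (K : Finset ℕ)
    (hs : ∀ q ∈ W, (s q).card + t + n + 2 ≤ R) (hK : ∀ q ∈ W, palette N R f q (s q) ⊆ K)
    (hk : K.card ≤ k) (he : K.card ≤ 2 ^ t * e) :
    DiColorable r W (2 ^ (t * (k + 1) + 2 ^ e)) := by
  classical
  induction t generalizing W s K with
  | zero =>
    simpa using hf.diColorable_of_palette_subset hN hN' hn W s K (by simpa using hs) hK
      (by simpa using he)
  | succ t ih =>
    let good : V → Prop := fun q => ∃ x, (palette N R f q (insert x (s q))).card ≤ 2 ^ t * e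
    have hex : ∀ q, ∃ s' : Finset X, good q → s q ⊆ s' ∧ s'.card ≤ (s q).card + 1 ∧
        (palette N R f q s').card ≤ 2 ^ t * e := by
      intro q
      by_cases hq : good q
      · obtain ⟨x, hx⟩ := hq
        exact ⟨insert x (s q), fun _ => ⟨Finset.subset_insert _ _, Finset.card_insert_le _ _, hx⟩⟩
      · exact ⟨∅, fun h => absurd h hq⟩
    choose s' hs' using hex
    have hcol : ∀ K' : Finset ℕ, ∃ c : V → ℕ, K' ⊆ K → K'.card ≤ 2 ^ t * e →
        (∀ q, q ∈ W → good q → palette N R f q (s' q) = K' → c q < 2 ^ (t * (k + 1) + 2 ^ e)) ∧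
        ∀ p, p ∈ W → good p → palette N R f p (s' p) = K' →
        ∀ q, q ∈ W → good q → palette N R f q (s' q) = K' → r p q → c p ≠ c q := by
      intro K'
      by_cases hK' : K' ⊆ K ∧ K'.card ≤ 2 ^ t * e
      · obtain ⟨c, h1, h2⟩ := ih {q | q ∈ W ∧ good q ∧ palette N R f q (s' q) = K'} s' K'
          (fun q hq => by have := (hs' q hq.2.1).2.1; have := hs q hq.1; omega)
          (fun q hq => hq.2.2.subset) ((Finset.card_le_card hK'.1).trans hk) hK'.2
        exact ⟨c, fun _ _ => ⟨fun q a b d => h1 q ⟨a, b, d⟩,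
          fun p a b d q a' b' d' => h2 p ⟨a, b, d⟩ q ⟨a', b', d'⟩⟩⟩
      · exact ⟨fun _ => 0, fun h1 h2 => absurd ⟨h1, h2⟩ hK'⟩
    choose c hc using hcol
    have hsub : ∀ q ∈ W, good q → palette N R f q (s' q) ⊆ K :=
      fun q hq hg => (palette_anti (hs' q hg).1).trans (hK q hq)
    refine DiColorable.of_finset
      (fun q => if good q then some (palette N R f q (s' q), c (palette N R f q (s' q)) q) else none)
      (Finset.insertNone (K.powerset ×ˢ Finset.range (2 ^ (t * (k + 1) + 2 ^ e)))) ?_ ?_ ?_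
    · rw [Finset.card_insertNone, Finset.card_product, Finset.card_powerset, Finset.card_range]
      have h1 : 2 ^ K.card ≤ 2 ^ k := Nat.pow_le_pow_right two_pos hk
      have h2 : 1 ≤ 2 ^ k * 2 ^ (t * (k + 1) + 2 ^ e) := Nat.one_le_iff_ne_zero.2 (by positivity)
      calc 2 ^ K.card * 2 ^ (t * (k + 1) + 2 ^ e) + 1
          ≤ 2 ^ k * 2 ^ (t * (k + 1) + 2 ^ e) + 2 ^ k * 2 ^ (t * (k + 1) + 2 ^ e) := by gcongr
        _ = 2 ^ ((t + 1) * (k + 1) + 2 ^ e) := by ring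
    · intro q hq
      by_cases hg : good q
      · have := (hc _ (hsub q hq hg) (hs' q hg).2.2).1 q hq hg rfl
        simp [hg, hsub q hq hg, this]
      · simp [hg]
    · -- Colours can only agree between two good vertices with the same halved palette, or between
      -- two vertices that are not good.
      intro p hp q hq hr heq
      by_cases hgp : good p <;> by_cases hgq : good q <;>
        simp only [hgp, hgq, if_true, if_false, Option.some.injEq, Prod.mk.injEq,
          reduceCtorEq] at heq
      · obtain ⟨h1, h2⟩ := heq
        rw [← h1] at h2
        exact (hc _ (hsub p hp hgp) (hs' p hgp).2.2).2 p hp hgp rfl q hq hgq h1.symm hr h2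
      · obtain ⟨y, hy⟩ := hN p q hr
        obtain ⟨z, hz⟩ := hN' p q hr
        have hd : Disjoint (palette N R f p (insert y (s p)))
            (palette N R f q (insert z (s q))) := by
          refine hf.disjoint_palette hr (hy.trans ?_) (hz.trans ?_) <;>
            (intro a; simp only [Finset.mem_union, Finset.mem_insert]; tauto)
        have h1 := Finset.card_le_card (Finset.union_subset
          ((palette_anti (Finset.subset_insert y (s p))).trans (hK p hp))
          ((palette_anti (Finset.subset_insert z (s q))).trans (hK q hq)))
        rw [Finset.card_union_of_disjoint hd] at h1
        have h2 : ¬ _ ≤ _ := fun h => hgp ⟨y, h⟩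
        have h3 : ¬ _ ≤ _ := fun h => hgq ⟨z, h⟩
        rw [pow_succ] at he
        have h4 : 2 ^ t * 2 * e = 2 * (2 ^ t * e) := by ring
        omega

end Digraph

/-! ### Shift graphs -/

/-- The arcs of the shift graph on increasing `n`-tuples: the first and the last `n` entries of an
increasing `(n + 1)`-tuple. -/
def Shift (m n : ℕ) (p q : Fin n → Fin m) : Prop :=
  ∃ w : Fin (n + 1) → Fin m, StrictMono w ∧ p = Fin.init w ∧ q = Fin.tail w

/-- An `(n + 1)`-tuple is coloured by the set of colours of its extensions by a last entry. -/
theorem diColorable_shift_of_succ {m n M : ℕ}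
    (h : DiColorable (Shift m (n + 2)) Set.univ M) :
    DiColorable (Shift m (n + 1)) Set.univ (2 ^ M) := by
  classical
  obtain ⟨c, hc, hr⟩ := h
  refine DiColorable.of_finset (fun x => (Finset.univ.filter fun w : Fin (n + 2) → Fin m =>
    StrictMono w ∧ Fin.init w = x).image c) (Finset.range M).powerset (by simp) ?_ ?_
  · intro x _
    rw [Finset.mem_powerset]
    intro a ha
    obtain ⟨w, -, rfl⟩ := Finset.mem_image.1 ha
    exact Finset.mem_range.2 (hc w trivial)
  · rintro _ - _ - ⟨w, hw, rfl, rfl⟩ heq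
    have hmem : c w ∈ (Finset.univ.filter fun w' : Fin (n + 2) → Fin m =>
        StrictMono w' ∧ Fin.init w' = Fin.tail w).image c := by
      rw [← heq]
      exact Finset.mem_image_of_mem _ (by simp [hw])
    simp only [Finset.mem_image, Finset.mem_filter, Finset.mem_univ, true_and] at hmem
    obtain ⟨w', ⟨hw', hi⟩, hcw⟩ := hmem
    refine hr w trivial w' trivial ⟨Fin.cons (w 0) w', ?_, ?_, ?_⟩ hcw.symm
    · rw [Fin.strictMono_iff_lt_succ]
      intro i
      refine Fin.cases ?_ (fun j => ?_) i
      · have h0 : w' 0 = w 1 := congrFun hi 0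
        simp only [Fin.castSucc_zero, Fin.cons_zero, Fin.cons_succ, h0]
        exact hw Fin.zero_lt_one
      · rw [← Fin.succ_castSucc, Fin.cons_succ, Fin.cons_succ]
        exact hw' Fin.castSucc_lt_succ
    · have h0 : Fin.init (α := fun _ => Fin m) (Fin.cons (w 0) w' : Fin (n + 3) → Fin m) =
          Fin.cons (w 0) (Fin.init w') := by
        ext i
        refine Fin.cases rfl (fun j => ?_) i
        simp only [Fin.init, Fin.cons_succ, ← Fin.succ_castSucc]
      rw [h0, hi, Fin.cons_self_tail]
    · rw [Fin.tail_cons]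

theorem le_of_diColorable_shift_one {m M : ℕ} (h : DiColorable (Shift m 1) Set.univ M) :
    m ≤ M := by
  obtain ⟨c, hc, hr⟩ := h
  have hlt : ∀ x y : Fin m, x < y → c ![x] ≠ c ![y] := by
    intro x y hxy
    refine hr _ trivial _ trivial ⟨![x, y], ?_, ?_, ?_⟩
    · rw [Fin.strictMono_iff_lt_succ]
      intro i
      fin_cases i
      exact hxy
    · ext i; fin_cases i; rfl
    · ext i; fin_cases i; rfl
  have hinj : Function.Injective fun x : Fin m => (⟨c ![x], hc _ trivial⟩ : Fin M) := by
    intro x y hxy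
    by_contra hne
    rcases lt_or_gt_of_ne hne with h | h
    · exact hlt x y h (Fin.val_eq_of_eq hxy)
    · exact hlt y x h (Fin.val_eq_of_eq hxy).symm
  simpa using Fintype.card_le_of_injective _ hinj

theorem le_iterate_of_diColorable_shift {m n M : ℕ}
    (h : DiColorable (Shift m (n + 1)) Set.univ M) : m ≤ (fun x => 2 ^ x)^[n] M := by
  induction n generalizing M with
  | zero => exact le_of_diColorable_shift_one h
  | succ n ih => exact ih (diColorable_shift_of_succ h)

/-! ### Chains around increasing tuples -/

/-- The sets of the chain around the middle entry of the `(2d + 1)`-tuple `x`: for `i ≤ d` the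
entries at distance at most `i` from the middle, and on top, at `i = d + 1`, the set `S` joined
with all entries, so that the chain is nested for every `S`. -/
def centredSet {m d : ℕ} (x : Fin (2 * d + 1) → Fin m) (S : Finset (Fin m)) (i : ℕ) :
    Finset (Fin m) :=
  if i ≤ d then (Finset.univ.filter fun j : Fin (2 * d + 1) => d ≤ j + i ∧ j ≤ d + i).image x
  else Finset.univ.image x ∪ S

theorem centredSet_zero {m d : ℕ} (x : Fin (2 * d + 1) → Fin m) (S : Finset (Fin m)) :
    centredSet x S 0 = {x ⟨d, by omega⟩} := by
  have h : (Finset.univ.filter fun j : Fin (2 * d + 1) => d ≤ j + 0 ∧ (j : ℕ) ≤ d + 0) =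
      {⟨d, by omega⟩} := by
    ext j
    simp only [Finset.mem_filter, Finset.mem_univ, true_and, Finset.mem_singleton, Fin.ext_iff]
    omega
  rw [centredSet, if_pos (Nat.zero_le d), h, Finset.image_singleton]

/-- The chain of length `d + 1` formed by the sets `centredSet x S i`. -/
def centredChain {m d : ℕ} (x : Fin (2 * d + 1) → Fin m) (S : Finset (Fin m)) :
    Chain m (d + 1) where
  set i := centredSet x S i
  nested i := by
    have hi := i.is_lt
    simp only [centredSet, Fin.val_castSucc, Fin.val_succ]
    rw [if_pos (by omega)]
    split_ifs
    · apply Finset.image_subset_image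
      intro j
      simp only [Finset.mem_filter, Finset.mem_univ, true_and]
      omega
    · exact (Finset.image_subset_image (Finset.subset_univ _)).trans Finset.subset_union_left
  card_zero := by
    rw [Fin.val_zero, centredSet_zero, Finset.card_singleton]

theorem centredChain_set_zero {m d : ℕ} (x : Fin (2 * d + 1) → Fin m) (S : Finset (Fin m)) :
    (centredChain x S).set 0 = {x ⟨d, by omega⟩} :=
  centredSet_zero x S

theorem size_centredChain {m d : ℕ} {x : Fin (2 * d + 1) → Fin m} {S : Finset (Fin m)}
    (h : Finset.univ.image x ⊆ S) : (centredChain x S).size = S.card := by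
  simp [Chain.size, centredChain, centredSet, Finset.union_eq_right.2 h]

theorem centredSet_init_subset {m d : ℕ} (w : Fin (2 * d + 2) → Fin m) {S T : Finset (Fin m)}
    (hT : Finset.univ.image (Fin.init (α := fun _ => Fin m) w) ⊆ T) {i : ℕ} (hi : i ≤ d) :
    centredSet (d := d) (Fin.init w) S i ⊆ centredSet (d := d) (Fin.tail w) T (i + 1) := by
  unfold centredSet
  rw [if_pos hi]
  split_ifs with h
  · intro a
    simp only [Finset.mem_image, Finset.mem_filter, Finset.mem_univ, true_and]
    rintro ⟨j, hj, rfl⟩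
    have hj' := j.is_lt
    refine ⟨⟨j - 1, by omega⟩, by simp only; omega, ?_⟩
    simp only [Fin.init, Fin.tail]
    congr 1
    ext
    simp only [Fin.val_succ, Fin.val_castSucc]
    omega
  · exact (Finset.image_subset_image (Finset.subset_univ _)).trans
      (hT.trans Finset.subset_union_right)

theorem centredSet_tail_subset {m d : ℕ} (w : Fin (2 * d + 2) → Fin m) {S T : Finset (Fin m)}
    (hS : Finset.univ.image (Fin.tail (α := fun _ => Fin m) w) ⊆ S) {i : ℕ} (hi : i ≤ d) :
    centredSet (d := d) (Fin.tail w) T i ⊆ centredSet (d := d) (Fin.init w) S (i + 1) := by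
  unfold centredSet
  rw [if_pos hi]
  split_ifs with h
  · intro a
    simp only [Finset.mem_image, Finset.mem_filter, Finset.mem_univ, true_and]
    rintro ⟨j, hj, rfl⟩
    have hj' := j.is_lt
    exact ⟨⟨j + 1, by omega⟩, by simp only; omega, rfl⟩
  · exact (Finset.image_subset_image (Finset.subset_univ _)).trans
      (hS.trans Finset.subset_union_right)

/-- Moving the middle one step along the shift graph moves every set of the chain into the next
set of the other chain: the entries at distance at most `i` from one middle are at distance at
most `i + 1` from the other. -/
theorem adj_centredChain {m R d : ℕ} {p q : Fin (2 * d + 1) → Fin m} (h : Shift m (2 * d + 1) p q)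
    {S T : Finset (Fin m)} (hqS : Finset.univ.image q ⊆ S)
    (hpT : Finset.univ.image p ⊆ T) (hS : (centredChain p S).size ≤ R)
    (hT : (centredChain q T).size ≤ R) :
    (U m R (d + 1)).Adj ⟨centredChain p S, hS⟩ ⟨centredChain q T, hT⟩ := by
  obtain ⟨w, hw, rfl, rfl⟩ := h
  refine ⟨?_, fun i => ⟨?_, ?_⟩⟩
  · simp only [centredChain_set_zero, ne_eq, Finset.singleton_inj, Fin.init, Fin.tail]
    exact (hw Fin.castSucc_lt_succ).ne
  · exact centredSet_init_subset w hpT (Nat.lt_succ_iff.1 i.is_lt)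
  · exact centredSet_tail_subset w hqS (Nat.lt_succ_iff.1 i.is_lt)

theorem colorable_chiU (m R δ : ℕ) : (U m R δ).Colorable (chiU m R δ) :=
  SimpleGraph.chromaticNumber_le_iff_colorable.1 (coe_chiU m R δ).ge

/-- A colouring of the chains colours the shift graph on `(2d + 1)`-tuples. -/
theorem le_iterate_of_chiU_le {m d t e : ℕ} (he : chiU m (2 * d + 3 + t) (d + 1) ≤ 2 ^ t * e) :
    m ≤ (fun x => 2 ^ x)^[2 * d]
      (2 ^ (t * (chiU m (2 * d + 3 + t) (d + 1) + 1) + 2 ^ e)) := by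
  classical
  set R := 2 * d + 3 + t with hR
  obtain ⟨C⟩ := colorable_chiU m R (d + 1)
  let N : (Fin (2 * d + 1) → Fin m) → Finset (Fin m) := fun x => Finset.univ.image x
  let f : (Fin (2 * d + 1) → Fin m) → Finset (Fin m) → ℕ := fun x S =>
    if h : (centredChain x S).size ≤ R then C ⟨centredChain x S, h⟩ else 0
  have hf : IsTopColoring (Shift m (2 * d + 1)) N R f := by
    intro p q hpq S T hS hT h1 h2 h3 h4
    have hS' := (size_centredChain h1).trans_le hS
    have hT' := (size_centredChain h4).trans_le hT
    simp only [f, hS', hT', dif_pos]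
    exact fun h => C.valid (adj_centredChain hpq h2 h3 hS' hT') (Fin.ext h)
  have hN : ∀ p q, Shift m (2 * d + 1) p q → ∃ z, N q ⊆ insert z (N p) := by
    rintro _ _ ⟨w, -, rfl, rfl⟩
    refine ⟨w (Fin.last _), fun a ha => ?_⟩
    obtain ⟨j, -, rfl⟩ := Finset.mem_image.1 ha
    rcases Fin.eq_castSucc_or_eq_last j.succ with ⟨i, hi⟩ | hj
    · exact Finset.mem_insert_of_mem
        (Finset.mem_image.2 ⟨i, Finset.mem_univ _, (congrArg w hi).symm⟩)
    · exact Finset.mem_insert.2 (Or.inl (congrArg w hj))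
  have hN' : ∀ p q, Shift m (2 * d + 1) p q → ∃ z, N p ⊆ insert z (N q) := by
    rintro _ _ ⟨w, -, rfl, rfl⟩
    refine ⟨w 0, fun a ha => ?_⟩
    obtain ⟨j, -, rfl⟩ := Finset.mem_image.1 ha
    rcases Fin.eq_zero_or_eq_succ j.castSucc with hj | ⟨i, hi⟩
    · exact Finset.mem_insert.2 (Or.inl (congrArg w hj))
    · exact Finset.mem_insert_of_mem
        (Finset.mem_image.2 ⟨i, Finset.mem_univ _, (congrArg w hi).symm⟩)
  refine le_iterate_of_diColorable_shift (hf.diColorable hN hN' (n := 2 * d + 1)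
    (fun q => Finset.card_image_le.trans (by simp)) t Set.univ (fun _ => ∅)
    (Finset.range (chiU m R (d + 1))) (fun _ _ => by simp; omega) ?_ (by simp) (by simpa using he))
  intro q _ c hc
  simp only [palette, Finset.mem_image, Finset.mem_filter, Finset.mem_univ, true_and] at hc
  obtain ⟨S, ⟨h1, -, h3⟩, rfl⟩ := hc
  have hS := (size_centredChain h1).trans_le h3
  simp [f, hS]

/-! ### Iterated logarithms -/

theorem iterLog_succ (j : ℕ) (x : ℝ) : iterLog (j + 1) x = Real.logb 2 (iterLog j x) :=
  Function.iterate_succ_apply' _ _ _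

theorem tendsto_iterLog (j : ℕ) : Tendsto (fun m : ℕ => iterLog j (m : ℝ)) atTop atTop := by
  induction j with
  | zero => exact tendsto_natCast_atTop_atTop
  | succ j ih =>
    simp only [iterLog_succ]
    exact (Real.tendsto_logb_atTop one_lt_two).comp ih

theorem logb_two_pow (n : ℕ) : Real.logb 2 ((2 ^ n : ℕ) : ℝ) = n := by
  push_cast
  rw [Real.logb_pow, Real.logb_self_eq_one one_lt_two, mul_one]

theorem iterLog_le_of_le_iterate {j m M : ℕ} (hpos : ∀ i < j, 0 < iterLog i (m : ℝ))
    (h : m ≤ (fun x => 2 ^ x)^[j] M) : iterLog j (m : ℝ) ≤ M := by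
  induction j generalizing M with
  | zero => exact Nat.cast_le.2 h
  | succ j ih =>
    rw [iterLog_succ, ← logb_two_pow M]
    exact Real.logb_le_logb_of_le one_lt_two (hpos j (Nat.lt_succ_self j))
      (ih (fun i hi => hpos i (hi.trans (Nat.lt_succ_self j))) h)

theorem eventually_mul_add_lt_two_rpow (a b : ℝ) :
    ∀ᶠ x : ℝ in atTop, a * x + b + 2 * (2 : ℝ) ^ (x / 2) < 2 ^ x := by
  have hlog : 0 < Real.log 2 / 2 := by positivity
  have hexp : ∀ x : ℝ, Real.exp (Real.log 2 / 2 * x) = (2 : ℝ) ^ (x / 2) := fun x => by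
    rw [Real.rpow_def_of_pos two_pos]
    ring_nf
  have h1 : (fun x : ℝ => a * x + b) =o[atTop] fun x => Real.exp (Real.log 2 / 2 * x) := by
    have h := ((isLittleO_pow_exp_pos_mul_atTop (k := 1) hlog).const_mul_left a).add
      ((isLittleO_pow_exp_pos_mul_atTop (k := 0) hlog).const_mul_left b)
    simpa using h
  filter_upwards [h1.bound one_pos, eventually_ge_atTop (4 : ℝ)] with x hx h4
  rw [Real.norm_eq_abs, Real.norm_eq_abs, hexp, one_mul,
    abs_of_pos (a := (2 : ℝ) ^ (x / 2)) (by positivity)] at hx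
  have h5 : (4 : ℝ) ≤ 2 ^ (x / 2) := by
    have h := Real.rpow_le_rpow_of_exponent_le one_le_two (show (2 : ℝ) ≤ x / 2 by linarith)
    norm_num at h
    exact h
  have h6 : (2 : ℝ) ^ x = 2 ^ (x / 2) * 2 ^ (x / 2) := by
    rw [← Real.rpow_add two_pos, add_halves]
  have h7 := le_abs_self (a * x + b)
  rw [h6]
  nlinarith

end ChainGraph

open ChainGraph in
theorem mainTheorem5 (R δ : ℕ) (hδ : 1 ≤ δ) (hR : 2 * δ + 1 ≤ R) :
    ∃ ε : ℕ → ℝ, Tendsto ε atTop (𝓝 0) ∧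
      ∀ᶠ m : ℕ in atTop,
        (ChainGraph.chiU m R δ : ℝ) >
          (2 : ℝ) ^ (((R : ℝ) - 2 * (δ : ℝ) - 4) / 2) * ChainGraph.iterLog (2 * δ) (m : ℝ)
            + ε m := by
  obtain ⟨d, rfl⟩ := Nat.exists_eq_add_of_le' hδ
  obtain ⟨t, rfl⟩ := Nat.exists_eq_add_of_le hR
  rw [show 2 * (d + 1) + 1 + t = 2 * d + 3 + t by ring]
  refine ⟨fun _ => 0, tendsto_const_nhds, ?_⟩
  -- The logarithm is monotone on positive reals only, so all iterates have to be positive.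
  have hpos : ∀ᶠ m : ℕ in atTop, ∀ i ∈ Set.Iio (2 * d + 2), 0 < iterLog i (m : ℝ) :=
    (Set.finite_Iio _).eventually_all.2 fun i _ => (tendsto_iterLog i).eventually_gt_atTop 0
  filter_upwards [hpos, (tendsto_iterLog (2 * (d + 1))).eventually_ge_atTop 0,
    (tendsto_iterLog (2 * (d + 1))).eventually
      (eventually_mul_add_lt_two_rpow (t * (2 ^ t / 2)) t)] with m hm hL hlt
  rw [add_zero]
  by_contra! hk
  set k := chiU m (2 * d + 3 + t) (d + 1) with hkdef
  set L := iterLog (2 * (d + 1)) (m : ℝ) with hLdef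
  -- The factor `2 ^ t` gained from the `t` spare elements exceeds twice the claimed coefficient.
  have hc : (2 : ℝ) ^ ((((2 * d + 3 + t : ℕ) : ℝ) - 2 * ((d + 1 : ℕ) : ℝ) - 4) / 2) ≤
      2 ^ t / 2 := by
    rw [← Real.rpow_natCast, ← Real.rpow_sub_one two_ne_zero]
    apply Real.rpow_le_rpow_of_exponent_le one_le_two
    push_cast
    have : (0 : ℝ) ≤ t := t.cast_nonneg
    linarith
  have hkL : (k : ℝ) ≤ 2 ^ t / 2 * L := hk.trans (mul_le_mul_of_nonneg_right hc hL)
  have hke : k ≤ 2 ^ t * (k / 2 ^ t + 1) := (Nat.lt_mul_div_succ k (by positivity)).le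
  -- With `e = k / 2 ^ t + 1`, this bounds `2 ^ L` by `t * (k + 1) + 2 ^ e`.
  have hm' := le_iterate_of_chiU_le hke
  rw [← Function.iterate_succ_apply (fun x => 2 ^ x) (2 * d)] at hm'
  have h1 := iterLog_le_of_le_iterate (fun i hi => hm i (Set.mem_Iio.2 (by omega))) hm'
  have h2 : (2 : ℝ) ^ L = iterLog (2 * d + 1) (m : ℝ) := by
    rw [hLdef, show 2 * (d + 1) = 2 * d + 1 + 1 by ring, iterLog_succ]
    exact Real.rpow_logb two_pos (by norm_num) (hm _ (by simp))
  rw [Nat.succ_eq_add_one, ← h2, ← hkdef] at h1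
  have h3 : ((k / 2 ^ t + 1 : ℕ) : ℝ) ≤ L / 2 + 1 := by
    have h := Nat.cast_div_le (α := ℝ) (m := k) (n := 2 ^ t)
    have h' : (k : ℝ) / 2 ^ t ≤ L / 2 := by
      rw [div_le_iff₀ (by positivity)]
      linarith
    push_cast at h ⊢
    linarith
  have h4 : (2 : ℝ) ^ (k / 2 ^ t + 1) ≤ 2 * 2 ^ (L / 2) := by
    rw [← Real.rpow_natCast]
    refine (Real.rpow_le_rpow_of_exponent_le one_le_two h3).trans_eq ?_
    rw [Real.rpow_add_one two_ne_zero, mul_comm]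
  have h5 : (t : ℝ) * (k + 1) ≤ t * (2 ^ t / 2) * L + t := by
    have := mul_le_mul_of_nonneg_left hkL t.cast_nonneg
    linarith
  push_cast at h1
  linarith
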